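/- **Setting.** A configuration is a map $\eta:\mathbb Z\to\mathbb Z\cup\{-\infty\}$; $\eta(x)=c\in\mathbb Z$ means that a particle of color $c$ is at $x$, and $\eta(x)=-\infty$ that $x$ is empty. In the colored TASEP, independent rate-$1$ Poisson clocks are attached to the bonds $(x,x+1)$, $x\in\mathbb Z$, and are independent of the (random or deterministic) initial configuration $\eta_0$. When the clock of $(x,x+1)$ rings, the particle at $x$ (if any) swaps places with the content of $x+1$ if $x+1$ is empty or occupied by a particle of strictly lower color; otherwise nothing happens. Write $\eta_t$ for the configuration at time $t\ge 0$; it may contain infinitely many particles. For $c\in\mathbb Z$ let $A_c(\eta)=\{x\in\mathbb Z:\eta(x)\ge c\}$. Let $n\ge1$ and let $C=(c_1<\dots<c_n)$ be integers. Call $\eta$ *admissible* if $|A_{c_i}(\eta)|\ge n-i+1$ and $A_{c_i}(\eta)$ is bounded above for each $i=1,\dots,n$. For admissible $\eta$ define $\mathcal M_C(\eta)=(k_1,\dots,k_n)\in\mathbb Z^n$ recursively, for $i=n,n-1,\dots,1$, by $$k_i=\max\bigl(A_{c_i}(\eta)\setminus\{k_{i+1},\dots,k_n\}\bigr).$$ **Proposition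 2.3.** Let $(\eta_t)_{t\ge0}$ be a colored TASEP such that, almost surely, $\eta_0$ is admissible and $\mathcal M_C(\eta_0)=\nu$ for a deterministic $\nu\in\mathbb Z^n$. Then almost surely $\eta_t$ is admissible for all $t\ge0$, and the process $\mathcal M_C(t):=\mathcal M_C(\eta_t)$ evolves exactly as the colored TASEP with $n$ particles of colors $1,\dots,n$ started at positions $\nu_1,\dots,\nu_n$: placing particles of colors $1,\dots,n$ at the coordinates of $\mathcal M_C(t)$, respectively, gives a colored TASEP (driven by the same clocks), and $(\mathcal M_C(t))_{t\ge0}$ has the same finite-dimensional distributions as the process of positions of the $n$ particles in any colored TASEP that starts from exactly $n$ particles, of colors $1,\dots,n$, at positions $\nu_1,\dots,\nu_n$. In particular, for all $t\ge0$ and $\mu\in\mathbb Z^n$, $\mathrm{Prob}\{\mathcal M_C(t)=\mu\}$ equals the probability that in the $n$-particle colored TASEP with particles of colors $1,\dots,n$ initially at $\nu_1,\dots,\nu_n$, the positions of these particles at time $t$ are $\mu_1,\dots,\mu_n$, respectively. -/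

import Mathlib

open MeasureTheory ProbabilityTheory Filter Topology
open scoped NNReal ENNReal

namespace ColoredTASEP

/-- A particle configuration `η : ℤ → ℤ ∪ {-∞}`: `η x = c` with `c : ℤ` is a particle of color `c`
at the site `x`, and `η x = ⊥` (playing the role of `-∞`) is an empty site. -/
abbrev Config : Type := ℤ → WithBot ℤ

/-- `ℤ ∪ {-∞}` carries the discrete σ-algebra, and configurations the product σ-algebra. -/
instance colorMeasurableSpace : MeasurableSpace (WithBot ℤ) := ⊤

/-! ### The colored TASEP (right jump rate 1, left jump rate 0) -/

/-- What a ring of the clock at the bond `(x, x + 1)` does: the particle at `x` (if there is one)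
tries to jump to `x + 1`. If `x + 1` is empty or has a particle of strictly lower color, the
contents of the two sites are swapped; otherwise, and also when `x` is empty, nothing happens. -/
noncomputable def jump (x : ℤ) (η : Config) : Config :=
  if η (x + 1) < η x then η ∘ Equiv.swap x (x + 1) else η

section Clocks

variable {Ω : Type*}

/-- `gap x k` is the waiting time between the `k`-th ring (the time origin if `k = 0`) and the
`(k+1)`-st ring of the clock at the bond `(x, x + 1)`. All waiting times are independent and
exponential of rate `1`, that is, the clocks are independent Poisson processes of rate `1`. -/
structure IsClockFamily [MeasurableSpace Ω] (P : Measure Ω) (gap : ℤ → ℕ → Ω → ℝ) : Prop where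
  exponential : ∀ x k, HasLaw (gap x k) (expMeasure 1) P
  indep : iIndepFun (fun p : ℤ × ℕ => gap p.1 p.2) P

/-- The set of all times at which the clock at `(x, x + 1)` rings, for the outcome `ω`. -/
def ringTimes (gap : ℤ → ℕ → Ω → ℝ) (ω : Ω) (x : ℤ) : Set ℝ≥0 :=
  {t | ∃ k : ℕ, ∑ j ∈ Finset.range (k + 1), gap x j ω = (t : ℝ)}

end Clocks

/-- The trajectory `η` follows the graphical construction with ring times `R x` of the clocks at
the bonds `(x, x + 1)`:
the content of a site `y` stays the same as long as neither `(y - 1, y)` nor `(y, y + 1)` rings, and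
when `(x, x + 1)` rings at time `t`, the contents of `x` and `x + 1` at time `t` result by `jump x`
from the configuration immediately before `t`. -/
structure IsTrajectory (R : ℤ → Set ℝ≥0) (η : ℝ≥0 → Config) : Prop where
  const : ∀ (y : ℤ) (s t : ℝ≥0), s ≤ t →
    (∀ r, s < r → r ≤ t → r ∉ R (y - 1) ∧ r ∉ R y) → η t y = η s y
  update : ∀ (x : ℤ) (t : ℝ≥0), t ∈ R x →
    ∀ᶠ s in 𝓝[<] t, η t x = jump x (η s) x ∧ η t (x + 1) = jump x (η s) (x + 1)

/-- `η` is a colored TASEP on the probability space `(Ω, P)`, driven by the clocks `gap`: its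
(possibly random) initial configuration is independent of the clocks, and almost every trajectory
follows the graphical construction. -/
structure IsColoredTASEP {Ω : Type*} [MeasurableSpace Ω] (P : Measure Ω)
    (gap : ℤ → ℕ → Ω → ℝ) (η : ℝ≥0 → Ω → Config) : Prop where
  clocks : IsClockFamily P gap
  aemeasurable_init : AEMeasurable (η 0) P
  indep_init : IndepFun (η 0) (fun ω (p : ℤ × ℕ) => gap p.1 p.2 ω) P
  trajectory : ∀ᵐ ω ∂P, IsTrajectory (ringTimes gap ω) (fun t => η t ω)

/-! ### The recursive maxima -/

/-- The set `A_c(η)` of positions of particles of color at least `c`. -/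
def colorSet (c : ℤ) (η : Config) : Set ℤ := {x | (c : WithBot ℤ) ≤ η x}

/-- The condition under which the recursive maxima are defined. The cutoffs are
indexed from `0`, so that the `1`-based bound `n - i + 1` reads `n - i`. -/
def Admissible {n : ℕ} (C : Fin n → ℤ) (η : Config) : Prop :=
  ∀ i : Fin n, ((n - (i : ℕ) : ℕ) : ℕ∞) ≤ (colorSet (C i) η).encard ∧ BddAbove (colorSet (C i) η)

/-- The recursive maxima `M_C(η) = (k_1, …, k_n)`: going down from the last index,
`k_i = max (A_{c_i}(η) \ {k_{i+1}, …, k_n})`. For admissible `η` these are true maxima,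
see `isGreatest_maxima`. -/
noncomputable def maxima {n : ℕ} (C : Fin n → ℤ) (η : Config) (i : Fin n) : ℤ :=
  sSup (colorSet (C i) η \ {x | ∃ j : Fin n, ∃ _ : i < j, maxima C η j = x})
termination_by n - (i : ℕ)
decreasing_by omega

theorem isGreatest_maxima {n : ℕ} {C : Fin n → ℤ} {η : Config}
    (h : Admissible C η) (i : Fin n) :
    IsGreatest (colorSet (C i) η \ {x | ∃ j : Fin n, i < j ∧ maxima C η j = x})
      (maxima C η i) := by
  have e : {x | ∃ j : Fin n, ∃ _ : i < j, maxima C η j = x} = maxima C η '' Set.Ioi i := by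
    ext x; simp
  have e' : {x | ∃ j : Fin n, i < j ∧ maxima C η j = x} = maxima C η '' Set.Ioi i := by
    ext x; simp
  have hb : BddAbove (colorSet (C i) η \ maxima C η '' Set.Ioi i) :=
    (h i).2.mono Set.sdiff_subset
  have hne : (colorSet (C i) η \ maxima C η '' Set.Ioi i).Nonempty := by
    rw [Set.sdiff_nonempty]
    intro hs
    have h1 := (h i).1.trans ((Set.encard_le_encard hs).trans (Set.encard_image_le _ _))
    have h2 : (Set.Ioi i).encard = ((n - 1 - (i : ℕ) : ℕ) : ℕ∞) := by
      rw [← Finset.coe_Ioi, Set.encard_coe_eq_coe_finsetCard, Fin.card_Ioi]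
    rw [h2] at h1
    have h3 : n - (i : ℕ) ≤ n - 1 - (i : ℕ) := by exact_mod_cast h1
    omega
  rw [e', maxima, e]
  exact ⟨Int.csSup_mem hne hb, fun x hx => le_csSup hb hx⟩

/-! ### The system of `n` particles of colors `1, …, n` -/

/-- The color `i` of the `i`-th particle (`1`-based; in terms of `i : Fin n` it is `i + 1`). -/
def label {n : ℕ} (i : Fin n) : WithBot ℤ := (((i : ℕ) + 1 : ℤ) : WithBot ℤ)

/-- For pairwise distinct positions `ν_1, …, ν_n`: the configuration that consists of
`n` particles of colors `1, …, n` at the positions `ν_1, …, ν_n`, respectively. -/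
def particles {n : ℕ} (ν : Fin n → ℤ) : Config :=
  fun x => Finset.univ.sup fun i => if ν i = x then label i else ⊥

theorem particles_apply {n : ℕ} {ν : Fin n → ℤ} (hν : Function.Injective ν) (i : Fin n) :
    particles ν (ν i) = label i := by
  refine le_antisymm (Finset.sup_le fun j _ => ?_) ?_
  · split_ifs with hj
    · rw [hν hj]
    · exact bot_le
  · exact le_trans (by simp)
      (Finset.le_sup (f := fun j => if ν j = ν i then label j else ⊥) (Finset.mem_univ i))

theorem particles_eq_bot {n : ℕ} {ν : Fin n → ℤ} {x : ℤ} (hx : ∀ i, ν i ≠ x) :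
    particles ν x = ⊥ := by
  simp [particles, hx]

end ColoredTASEP

/-! The core is a deterministic statement about one ring: taking recursive maxima commutes with a
jump (`particles_maxima_jump`). Either the marked particles swap together with the full
configuration, or they stay put. The delicate case is a swap of the contents of `x` and `x + 1` that
the marked particles ignore: every cutoff that separates the two contents then has its maximum at `x
+ 1` or beyond, so no maximum moves.

To pass from one ring to infinitely many particles, fix a time horizon. Almost surely there are
bonds arbitrarily far to the left and to the right that stay silent up to that time. They enclose a
finite block which evolves on its own through finitely many rings, no two bonds ringing
simultaneously. By admissibility the initial block can be chosen to contain enough particles for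
every cutoff, with no relevant particle to its right; what lies to its left then never affects the
maxima. Induction over the rings gives `IsTrajectory.admissible` and
`IsTrajectory.particles_maxima`, so the marked particles follow the graphical construction with the
same clocks.

Equality in law is uniqueness of the graphical construction in measurable form. For good clocks each
site of a trajectory is the eventual value of `meshApprox`, a measurable function of the waiting
times once the initial configuration is fixed. Probabilities of cylinder events therefore depend
only on that configuration and on `gapLaw` (`IsColoredTASEP.measure_eq`), and this applies both to
the marked particles and to any `n`-particle system. -/

namespace ColoredTASEP

/-! ### Recursive maxima and jumps -/

section Combinatorics

variable {n : ℕ} {C : Fin n → ℤ} {η : Config}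

/-- The recursive maxima are the only solution of their defining recursion. -/
theorem maxima_eq_of_isGreatest {k : Fin n → ℤ}
    (h : ∀ i, IsGreatest (colorSet (C i) η \ {x | ∃ j : Fin n, i < j ∧ k j = x}) (k i)) :
    maxima C η = k := by
  have main : ∀ m : ℕ, ∀ i : Fin n, n - (i : ℕ) = m → maxima C η i = k i := by
    intro m
    induction m using Nat.strong_induction_on with
    | _ m ih =>
      intro i hi
      have e : {x | ∃ j : Fin n, ∃ _ : i < j, maxima C η j = x} =
          {x | ∃ j : Fin n, i < j ∧ k j = x} := by
        ext x
        constructor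
        · rintro ⟨j, hj, rfl⟩
          exact ⟨j, hj, (ih (n - j) (by omega) j rfl).symm⟩
        · rintro ⟨j, hj, rfl⟩
          exact ⟨j, hj, ih (n - j) (by omega) j rfl⟩
      rw [maxima, e]
      exact (h i).csSup_eq
  exact funext fun i => main _ i rfl

theorem maxima_mem (h : Admissible C η) (i : Fin n) : maxima C η i ∈ colorSet (C i) η :=
  (isGreatest_maxima h i).1.1

theorem maxima_injective (h : Admissible C η) : Function.Injective (maxima C η) := by
  intro i j hij
  rcases lt_trichotomy i j with hlt | rfl | hlt
  · exact absurd ⟨j, hlt, hij.symm⟩ (isGreatest_maxima h i).1.2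
  · rfl
  · exact absurd ⟨i, hlt, hij⟩ (isGreatest_maxima h j).1.2

/-- Every site of color at least `C i` is a later maximum or lies weakly to the left of the `i`-th
maximum. -/
theorem le_maxima_or (h : Admissible C η) (i : Fin n) {y : ℤ} (hy : y ∈ colorSet (C i) η) :
    (∃ j, i < j ∧ maxima C η j = y) ∨ y ≤ maxima C η i := by
  by_cases hj : ∃ j, i < j ∧ maxima C η j = y
  · exact Or.inl hj
  · exact Or.inr ((isGreatest_maxima h i).2 ⟨hy, hj⟩)

theorem label_strictMono : StrictMono (label : Fin n → WithBot ℤ) := by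
  intro i j hij
  unfold label
  rw [WithBot.coe_lt_coe]
  have : (i : ℕ) < j := hij
  omega

theorem bot_lt_label (i : Fin n) : ⊥ < label i := WithBot.bot_lt_coe _

/-- Distinct particles have distinct labels, so events about positions can be read as events about
the contents of sites; this is how the two laws are compared at the end. -/
theorem particles_eq_label_iff {ν : Fin n → ℤ} (hν : Function.Injective ν) {x : ℤ} {i : Fin n} :
    particles ν x = label i ↔ ν i = x := by
  constructor
  · intro h
    by_cases hx : ∃ j, ν j = x
    · obtain ⟨j, rfl⟩ := hx
      rw [particles_apply hν] at h
      rw [label_strictMono.injective h]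
    · push Not at hx
      rw [particles_eq_bot hx] at h
      exact absurd h (bot_lt_label i).ne
  · rintro rfl
    exact particles_apply hν i

theorem particles_comp_perm {ν : Fin n → ℤ} (σ : Equiv.Perm ℤ) :
    particles (σ ∘ ν) = particles ν ∘ σ.symm := by
  funext x
  simp only [particles, Function.comp_apply, Equiv.eq_symm_apply]

theorem jump_of_lt {x : ℤ} (h : η (x + 1) < η x) : jump x η = η ∘ Equiv.swap x (x + 1) :=
  if_pos h

theorem jump_of_not_lt {x : ℤ} (h : ¬ η (x + 1) < η x) : jump x η = η := if_neg h

theorem jump_apply_of_ne {x y : ℤ} (h : y ≠ x) (h' : y ≠ x + 1) : jump x η y = η y := by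
  unfold jump
  split_ifs
  · simp [Equiv.swap_apply_of_ne_of_ne h h']
  · rfl

/-- A jump permutes the sites and moves no particle by more than one: the cardinalities are kept and
an upper bound grows by at most `1`. -/
theorem Admissible.jump (h : Admissible C η) (x : ℤ) : Admissible C (jump x η) := by
  intro i
  by_cases hx : η (x + 1) < η x
  · rw [jump_of_lt hx]
    have e : colorSet (C i) (η ∘ Equiv.swap x (x + 1)) =
        Equiv.swap x (x + 1) '' colorSet (C i) η := by
      ext y
      rw [Equiv.image_eq_preimage_symm]
      rfl
    rw [e, (Equiv.swap x (x + 1)).injective.encard_image]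
    refine ⟨(h i).1, ?_⟩
    obtain ⟨B, hB⟩ := (h i).2
    refine ⟨B + 1, ?_⟩
    rintro _ ⟨y, hy, rfl⟩
    have := hB hy
    rw [Equiv.swap_apply_def]
    split_ifs <;> omega
  · rw [jump_of_not_lt hx]
    exact h i

/-- A jump of the configuration acts on the particles at the recursive maxima as a jump of the
`n`-particle system. -/
theorem particles_maxima_jump (hC : StrictMono C) (h : Admissible C η) (x : ℤ) :
    particles (maxima C (jump x η)) = jump x (particles (maxima C η)) := by
  set k := maxima C η with hk
  have hinj : Function.Injective k := maxima_injective h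
  have hmem : ∀ i, (C i : WithBot ℤ) ≤ η (k i) := maxima_mem h
  have hle : ∀ i y, (C i : WithBot ℤ) ≤ η y → (∃ j, i < j ∧ k j = y) ∨ y ≤ k i :=
    fun i y hy => le_maxima_or h i hy
  by_cases hx : η (x + 1) < η x
  · rw [jump_of_lt hx]
    by_cases hp : particles k (x + 1) < particles k x
    · rw [jump_of_lt hp]
      have hi : ∃ i, k i = x := by
        by_contra hne
        push Not at hne
        rw [particles_eq_bot hne] at hp
        exact not_lt_bot hp
      obtain ⟨i, hi⟩ := hi
      have hpx : particles k x = label i := hi ▸ particles_apply hinj i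
      have hlt : ∀ j, k j = x + 1 → j < i := by
        intro j hj
        rw [hpx, ← hj, particles_apply hinj] at hp
        exact label_strictMono.lt_iff_lt.1 hp
      -- Both configurations swap, so the transposed old maxima are tested against the recursion.
      have hmax : maxima C (η ∘ Equiv.swap x (x + 1)) = Equiv.swap x (x + 1) ∘ k := by
        apply maxima_eq_of_isGreatest
        intro l
        refine ⟨⟨?_, ?_⟩, ?_⟩
        · simpa [colorSet] using hmem l
        · rintro ⟨j, hj, he⟩
          exact hj.ne' (hinj ((Equiv.swap x (x + 1)).injective he))
        · rintro y ⟨hy, hy'⟩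
          have hnot : ¬ ∃ j, l < j ∧ k j = Equiv.swap x (x + 1) y := by
            rintro ⟨j, hj, he⟩
            exact hy' ⟨j, hj, by simp [he]⟩
          have hyl : Equiv.swap x (x + 1) y ≤ k l := (hle l _ hy).resolve_left hnot
          -- The transposition preserves the order of all pairs except `x < x + 1`. That pair does
          -- not occur here: `x` is the maximum of an index `i > l` and has already been removed.
          have hcase : ¬ (Equiv.swap x (x + 1) y = x ∧ k l = x + 1) := by
            rintro ⟨h1, h2⟩
            exact hnot ⟨i, hlt l h2, hi.trans h1.symm⟩
          simp only [Function.comp_apply]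
          rw [Equiv.swap_apply_def] at hyl hcase ⊢
          split_ifs at hyl hcase ⊢ <;> omega
      rw [hmax, particles_comp_perm, Equiv.symm_swap]
    · rw [jump_of_not_lt hp]
      congr 1
      -- If no maximum is at `x`, then `x` competes for the index `l` and forces `k l > x`. If `k i
      -- = x`, the marked particles can only refuse to swap because `k j = x + 1` with `i ≤ j`; the
      -- cutoff `C l` exceeds the color at `x + 1`, so `i ≤ j < l`. Hence `x` is not removed before
      -- step `l`, and again `k l > x`.
      have key : ∀ l, (C l : WithBot ℤ) ≤ η x → ¬ (C l : WithBot ℤ) ≤ η (x + 1) →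
          k l ≠ x ∧ x + 1 ≤ k l := by
        intro l hlx hlx'
        have hl1 : k l ≠ x + 1 := fun he => hlx' (he ▸ hmem l)
        by_cases hi : ∃ i, k i = x
        · obtain ⟨i, hi⟩ := hi
          have hpx : particles k x = label i := hi ▸ particles_apply hinj i
          have hj : ∃ j, k j = x + 1 := by
            by_contra hne
            push Not at hne
            rw [particles_eq_bot hne, hpx] at hp
            exact hp (bot_lt_label i)
          obtain ⟨j, hj⟩ := hj
          have hij : i ≤ j := by
            rw [hpx, ← hj, particles_apply hinj, not_lt] at hp
            exact label_strictMono.le_iff_le.1 hp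
          have hjl : j < l := by
            by_contra hlj
            push Not at hlj
            refine hlx' (le_trans (WithBot.coe_le_coe.2 (hC.monotone hlj)) (hj ▸ hmem j))
          have hlx2 : k l ≠ x := by
            intro he
            exact absurd (hinj (he.trans hi.symm)) (lt_of_le_of_lt hij hjl).ne'
          refine ⟨hlx2, ?_⟩
          rcases hle l x hlx with ⟨j', hj', he⟩ | hle'
          · have := hinj (he.trans hi.symm)
            subst this
            exact absurd (hij.trans_lt hjl) (not_lt.2 hj'.le)
          · omega
        · push Not at hi
          refine ⟨hi l, ?_⟩
          rcases hle l x hlx with ⟨j', -, he⟩ | hle'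
          · exact absurd he (hi j')
          · have := hi l
            omega
      apply maxima_eq_of_isGreatest
      intro l
      refine ⟨⟨?_, ?_⟩, ?_⟩
      · change (C l : WithBot ℤ) ≤ η (Equiv.swap x (x + 1) (k l))
        have hl := hmem l
        by_cases h1 : k l = x
        · rw [h1] at hl ⊢
          rw [Equiv.swap_apply_left]
          by_contra hn
          exact (key l hl hn).1 h1
        · by_cases h2 : k l = x + 1
          · rw [h2] at hl ⊢
            rw [Equiv.swap_apply_right]
            exact hl.trans hx.le
          · rwa [Equiv.swap_apply_of_ne_of_ne h1 h2]
      · rintro ⟨j, hj, he⟩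
        exact hj.ne' (hinj he)
      · rintro y ⟨hy, hy'⟩
        change (C l : WithBot ℤ) ≤ η (Equiv.swap x (x + 1) y) at hy
        by_cases hly : (C l : WithBot ℤ) ≤ η y
        · exact (hle l y hly).resolve_left hy'
        · by_cases h1 : y = x
          · subst h1
            rw [Equiv.swap_apply_left] at hy
            exact absurd (hy.trans hx.le) hly
          · by_cases h2 : y = x + 1
            · subst h2
              rw [Equiv.swap_apply_right] at hy
              exact (key l hy hly).2
            · rw [Equiv.swap_apply_of_ne_of_ne h1 h2] at hy
              exact absurd hy hly
  -- If `k i = x`, then `x + 1` also has color at least `C i` but lies to the right of the `i`-th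
  -- maximum. So it is a later maximum, with a higher label, and blocks the marked particle too.
  · rw [jump_of_not_lt hx, ← hk, jump_of_not_lt]
    intro hp
    have hi : ∃ i, k i = x := by
      by_contra hne
      push Not at hne
      rw [particles_eq_bot hne] at hp
      exact not_lt_bot hp
    obtain ⟨i, hi⟩ := hi
    have hmi := hmem i
    rw [hi] at hmi
    rcases hle i (x + 1) (hmi.trans (not_lt.1 hx)) with ⟨j, hj, he⟩ | hle'
    · rw [← he, ← hi, particles_apply hinj, particles_apply hinj] at hp
      exact absurd (label_strictMono.lt_iff_lt.1 hp) hj.asymm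
    · omega

end Combinatorics

/-! ### Trajectories on finite blocks -/

/-- Properties of the ring times that hold almost surely. -/
structure GoodClocks (R : ℤ → Set ℝ≥0) : Prop where
  finite : ∀ x T, (R x ∩ Set.Iic T).Finite
  disjoint : ∀ x y t, t ∈ R x → t ∈ R y → x = y
  silent_left : ∀ (T : ℝ≥0) (a : ℤ), ∃ b < a, ∀ t ≤ T, t ∉ R b
  silent_right : ∀ (T : ℝ≥0) (a : ℤ), ∃ b > a, ∀ t ≤ T, t ∉ R b

/-- The bonds at both ends of the block of sites `a + 1, …, b` do not ring up to time `T`. -/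
structure IsBlock (R : ℤ → Set ℝ≥0) (T : ℝ≥0) (a b : ℤ) : Prop where
  lt : a < b
  left : ∀ t ≤ T, t ∉ R a
  right : ∀ t ≤ T, t ∉ R b

/-- The restriction of a configuration to the sites `a + 1, …, b`. -/
noncomputable def restr (a b : ℤ) (η : Config) : Config :=
  fun y => if a < y ∧ y ≤ b then η y else ⊥

section Blocks

variable {R : ℤ → Set ℝ≥0} {η : ℝ≥0 → Config} {T : ℝ≥0} {a b : ℤ}

theorem restr_apply_of_mem {ζ : Config} {y : ℤ} (h1 : a < y) (h2 : y ≤ b) :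
    restr a b ζ y = ζ y := if_pos ⟨h1, h2⟩

theorem restr_congr {ζ ζ' : Config} (h : ∀ y, a < y → y ≤ b → ζ y = ζ' y) :
    restr a b ζ = restr a b ζ' := by
  funext y
  unfold restr
  split_ifs with hy
  · exact h y hy.1 hy.2
  · rfl

theorem restr_jump {x : ℤ} (h1 : a < x) (h2 : x < b) (ζ : Config) :
    restr a b (jump x ζ) = jump x (restr a b ζ) := by
  funext y
  have e1 : restr a b ζ x = ζ x := restr_apply_of_mem h1 h2.le
  have e2 : restr a b ζ (x + 1) = ζ (x + 1) := restr_apply_of_mem (by omega) (by omega)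
  by_cases hy : a < y ∧ y ≤ b
  · rw [restr_apply_of_mem hy.1 hy.2]
    unfold jump
    rw [e1, e2]
    split_ifs
    · simp only [Function.comp_apply]
      rw [restr_apply_of_mem]
      all_goals
        rw [Equiv.swap_apply_def]
        split_ifs <;> omega
    · exact (restr_apply_of_mem hy.1 hy.2).symm
  · rw [jump_apply_of_ne (by omega) (by omega)]
    simp [restr, hy]

theorem restr_jump_of_not_mem {x : ℤ} (h : x < a ∨ b < x) (ζ : Config) :
    restr a b (jump x ζ) = restr a b ζ :=
  restr_congr fun y _ _ => jump_apply_of_ne (by omega) (by omega)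

theorem GoodClocks.finite_block (hR : GoodClocks R) (T : ℝ≥0) (a b : ℤ) :
    {r | r ≤ T ∧ ∃ x, a < x ∧ x < b ∧ r ∈ R x}.Finite := by
  refine ((Set.finite_Ioo a b).biUnion fun x _ => hR.finite x T).subset ?_
  rintro r ⟨hr, x, h1, h2, hx⟩
  exact Set.mem_biUnion (Set.mem_Ioo.2 ⟨h1, h2⟩) ⟨hx, hr⟩

/-- The boundary bonds are silent, so rings inside the block are the only ones that can change it.
-/
theorem IsTrajectory.restr_eq (hη : IsTrajectory R η) (hb : IsBlock R T a b) {s t : ℝ≥0}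
    (hst : s ≤ t) (htT : t ≤ T) (h : ∀ r x, s < r → r ≤ t → a < x → x < b → r ∉ R x) :
    restr a b (η t) = restr a b (η s) := by
  have key : ∀ r x, s < r → r ≤ t → a ≤ x → x ≤ b → r ∉ R x := by
    intro r x h1 h2 h3 h4
    rcases h3.eq_or_lt with rfl | h3
    · exact hb.left r (h2.trans htT)
    rcases h4.eq_or_lt with rfl | h4
    · exact hb.right r (h2.trans htT)
    exact h r x h1 h2 h3 h4
  refine restr_congr fun y h1 h2 => hη.const y s t hst fun r hr1 hr2 => ⟨?_, ?_⟩
  · exact key r _ hr1 hr2 (by omega) (by omega)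
  · exact key r _ hr1 hr2 (by omega) (by omega)

theorem IsTrajectory.eventually_restr_eq (hR : GoodClocks R) (hη : IsTrajectory R η)
    (hb : IsBlock R T a b) {t : ℝ≥0} (htT : t ≤ T) {x : ℤ} (hx : t ∈ R x) (hax : a < x)
    (hxb : x < b) : ∀ᶠ s in 𝓝[<] t, restr a b (η t) = jump x (restr a b (η s)) := by
  -- Only finitely many rings occur in the block, so `s` close to `t` comes after all the earlier
  -- ones.
  have hfin : ∀ᶠ s in 𝓝[<] t, ∀ r ∈ {r | r ≤ T ∧ ∃ x, a < x ∧ x < b ∧ r ∈ R x}, r < t → r < s := by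
    rw [eventually_all_finite (hR.finite_block T a b)]
    intro r _
    by_cases hr : r < t
    · filter_upwards [mem_nhdsWithin_of_mem_nhds (Ioi_mem_nhds hr)] with s hs _ using hs
    · exact Eventually.of_forall fun s h => absurd h hr
  filter_upwards [hfin, hη.update x t hx, self_mem_nhdsWithin] with s hs hup hst
  have hst : s < t := hst
  rw [← restr_jump hax hxb]
  have key : ∀ r z, s < r → r ≤ t → a ≤ z → z ≤ b → z ≠ x → r ∉ R z := by
    intro r z h1 h2 h3 h4 hne hz
    rcases h3.eq_or_lt with rfl | h3
    · exact hb.left r (h2.trans htT) hz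
    rcases h4.eq_or_lt with rfl | h4
    · exact hb.right r (h2.trans htT) hz
    rcases h2.eq_or_lt with rfl | h2
    · exact hne (hR.disjoint _ _ _ hz hx)
    · exact (hs r ⟨h2.le.trans htT, z, h3, h4, hz⟩ h2).not_gt h1
  refine restr_congr fun y h1 h2 => ?_
  by_cases hy1 : y = x
  · rw [hy1]
    exact hup.1
  by_cases hy2 : y = x + 1
  · rw [hy2]
    exact hup.2
  rw [jump_apply_of_ne hy1 hy2]
  refine hη.const y s t hst.le fun r hr1 hr2 => ⟨?_, ?_⟩
  · exact key r _ hr1 hr2 (by omega) (by omega) (by omega)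
  · exact key r _ hr1 hr2 (by omega) (by omega) (by omega)

/-- If `(s, t]` contains just one ring of the bonds inside of the block, then the block changes by
one jump. -/
theorem IsTrajectory.restr_eq_jump (hR : GoodClocks R) (hη : IsTrajectory R η)
    (hb : IsBlock R T a b) {s r t : ℝ≥0} (hsr : s < r) (hrt : r ≤ t) (htT : t ≤ T) {x : ℤ}
    (hx : r ∈ R x) (hax : a < x) (hxb : x < b)
    (h : ∀ r' z, s < r' → r' ≤ t → a < z → z < b → r' ∈ R z → r' = r) :
    restr a b (η t) = jump x (restr a b (η s)) := by
  rw [hη.restr_eq hb hrt htT fun r' z h1 h2 h3 h4 h5 => h1.ne' (h r' z (hsr.trans h1) h2 h3 h4 h5)]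
  -- In `ℝ≥0` the left neighbourhood filter is trivial at `0`; `s < r` excludes this.
  have : (𝓝[<] r).NeBot := nhdsLT_neBot_of_exists_lt ⟨s, hsr⟩
  obtain ⟨u, hu, hur, hsu⟩ := ((hη.eventually_restr_eq hR hb (hrt.trans htT) hx hax hxb).and
    ((eventually_mem_nhdsWithin).and (mem_nhdsWithin_of_mem_nhds (Ioi_mem_nhds hsr)))).exists
  have hur : u < r := hur
  have hsu : s < u := hsu
  rw [hu, hη.restr_eq hb hsu.le ((hur.le.trans hrt).trans htT) fun r' z h1 h2 h3 h4 h5 =>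
    (h2.trans_lt hur).ne (h r' z h1 ((h2.trans hur.le).trans hrt) h3 h4 h5)]

/-- Properties of the content of a block propagate from time `s` to time `t` if they are preserved
by the jumps at the bonds that ring between `s` and `t`. -/
theorem IsTrajectory.block_induction (hR : GoodClocks R) (hη : IsTrajectory R η)
    (hb : IsBlock R T a b) (Q : Config → Prop) {s t : ℝ≥0} (hst : s ≤ t) (htT : t ≤ T)
    (hs : Q (restr a b (η s)))
    (hjump : ∀ r x, s < r → r ≤ t → a < x → x < b → r ∈ R x → ∀ ζ, Q ζ → Q (jump x ζ)) :
    Q (restr a b (η t)) := by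
  -- Strong induction on the number of ring times in `(s, u]`: a time just before the last of them
  -- sees strictly fewer.
  have main : ∀ N : ℕ, ∀ u, s ≤ u → u ≤ t →
      {r | r ≤ u ∧ s < r ∧ ∃ x, a < x ∧ x < b ∧ r ∈ R x}.ncard = N → Q (restr a b (η u)) := by
    intro N
    induction N using Nat.strong_induction_on with
    | _ N ih =>
      intro u hsu hut hN
      set F := {r | r ≤ u ∧ s < r ∧ ∃ x, a < x ∧ x < b ∧ r ∈ R x} with hF
      have hFfin : F.Finite := (hR.finite_block u a b).subset fun r hr => ⟨hr.1, hr.2.2⟩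
      rcases F.eq_empty_or_nonempty with he | hne
      · rw [hη.restr_eq hb hsu (hut.trans htT)]
        · exact hs
        · intro r x h1 h2 h3 h4 h5
          exact Set.eq_empty_iff_forall_notMem.1 he r ⟨h2, h1, x, h3, h4, h5⟩
      · obtain ⟨r, ⟨hru, hsr, x, hax, hxb, hx⟩, hmax⟩ := Set.exists_max_image F id hFfin hne
        rw [hη.restr_eq hb hru (hut.trans htT) fun r' z h1 h2 h3 h4 h5 =>
          (hmax r' ⟨h2, hsr.trans h1, z, h3, h4, h5⟩).not_gt h1]
        have : (𝓝[<] r).NeBot := nhdsLT_neBot_of_exists_lt ⟨s, hsr⟩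
        obtain ⟨v, hv, hvr, hsv⟩ := ((hη.eventually_restr_eq hR hb ((hru.trans hut).trans htT)
          hx hax hxb).and ((eventually_mem_nhdsWithin).and
            (mem_nhdsWithin_of_mem_nhds (Ioi_mem_nhds hsr)))).exists
        have hvr : v < r := hvr
        have hsv : s < v := hsv
        rw [hv]
        refine hjump r x hsr (hru.trans hut) hax hxb hx _ (ih _ ?_ v hsv.le
          ((hvr.le.trans hru).trans hut) rfl)
        rw [← hN]
        refine Set.ncard_lt_ncard ⟨fun r' h' => ⟨(h'.1.trans hvr.le).trans hru, h'.2⟩, fun hsub => ?_⟩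
          hFfin
        exact (hsub ⟨hru, hsr, x, hax, hxb, hx⟩ : _ ∈ _).1.not_gt hvr
  exact main _ t hst le_rfl rfl

end Blocks

/-! ### The recursive maxima along a trajectory -/

section MaximaTrajectory

variable {R : ℤ → Set ℝ≥0} {η : ℝ≥0 → Config} {T : ℝ≥0} {a b : ℤ} {n : ℕ} {C : Fin n → ℤ}

theorem colorSet_restr_subset (c : ℤ) (ζ : Config) :
    colorSet c (restr a b ζ) ⊆ colorSet c ζ ∩ Set.Ioc a b := by
  intro y hy
  by_cases h : a < y ∧ y ≤ b
  · refine ⟨?_, h⟩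
    rwa [colorSet, Set.mem_ofPred_eq, restr_apply_of_mem h.1 h.2] at hy
  · simp [colorSet, restr, h] at hy

theorem colorSet_restr (c : ℤ) (ζ : Config) :
    colorSet c (restr a b ζ) = colorSet c ζ ∩ Set.Ioc a b := by
  refine (colorSet_restr_subset c ζ).antisymm ?_
  rintro y ⟨hy, h1, h2⟩
  rwa [colorSet, Set.mem_ofPred_eq, restr_apply_of_mem h1 h2]

theorem admissible_of_restr {ζ : Config} (h : Admissible C (restr a b ζ))
    (hright : ∀ i, ∀ y ∈ colorSet (C i) ζ, y ≤ b) : Admissible C ζ := fun i =>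
  ⟨(h i).1.trans (Set.encard_le_encard ((colorSet_restr_subset _ _).trans Set.inter_subset_left)),
    ⟨b, fun y hy => hright i y hy⟩⟩

/-- The maxima of the block are sites of the block, so particles to its left cannot compete with
them, and to its right there are none. -/
theorem maxima_restr {ζ : Config} (h : Admissible C (restr a b ζ))
    (hright : ∀ i, ∀ y ∈ colorSet (C i) ζ, y ≤ b) :
    maxima C ζ = maxima C (restr a b ζ) := by
  apply maxima_eq_of_isGreatest
  intro i
  obtain ⟨⟨h1, h2⟩, h3⟩ := isGreatest_maxima h i
  rw [colorSet_restr] at h1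
  refine ⟨⟨h1.1, h2⟩, ?_⟩
  rintro y ⟨hy, hy'⟩
  by_cases hya : a < y
  · refine h3 ⟨?_, hy'⟩
    rw [colorSet_restr]
    exact ⟨hy, hya, hright i y hy⟩
  · exact (not_lt.1 hya).trans h1.2.1.le

/-- For each cutoff choose `n - i` sites that witness the cardinality bound; the block has to
contain these finitely many sites and reach beyond all upper bounds. -/
theorem exists_block (hR : GoodClocks R) (T : ℝ≥0) {ζ : Config} (h : Admissible C ζ) :
    ∃ a b, IsBlock R T a b ∧ Admissible C (restr a b ζ) ∧
      ∀ i, ∀ y ∈ colorSet (C i) ζ, y ≤ b := by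
  choose S hS hScard using fun i => Set.exists_subset_encard_eq (h i).1
  have hSfin : ∀ i, (S i).Finite := fun i =>
    Set.finite_of_encard_eq_coe (hScard i)
  choose B hB using fun i => (h i).2
  obtain ⟨B', hB'⟩ := (Set.finite_range B).bddAbove
  obtain ⟨A, hA⟩ := (Set.finite_iUnion hSfin).bddBelow
  obtain ⟨b, hb, hbs⟩ := hR.silent_right T B'
  obtain ⟨a, ha, has⟩ := hR.silent_left T (min A b)
  have hright : ∀ i, ∀ y ∈ colorSet (C i) ζ, y ≤ b := fun i y hy =>
    ((hB i hy).trans (hB' ⟨i, rfl⟩)).trans hb.le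
  refine ⟨a, b, ⟨lt_of_lt_of_le ha (min_le_right _ _), has, hbs⟩, fun i => ⟨?_, ?_⟩, hright⟩
  · rw [← hScard i]
    refine Set.encard_le_encard fun y hy => ?_
    rw [colorSet_restr]
    exact ⟨hS i hy, lt_of_lt_of_le (ha.trans_le (min_le_left _ _))
      (hA (Set.mem_iUnion.2 ⟨i, hy⟩)), hright i y (hS i hy)⟩
  · exact ⟨b, fun y hy => (colorSet_restr_subset _ _ hy).2.2⟩

/-- No particle of color at least `c` gets beyond a silent bond. -/
theorem IsTrajectory.colorSet_le (hR : GoodClocks R) (hη : IsTrajectory R η)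
    (hb : ∀ t ≤ T, t ∉ R b) {c : ℤ} (h : ∀ y ∈ colorSet c (η 0), y ≤ b) {t : ℝ≥0} (ht : t ≤ T) :
    ∀ y ∈ colorSet c (η t), y ≤ b := by
  intro y hy
  by_contra hyb
  push Not at hyb
  -- A second silent bond beyond `y` closes a block `(b, d]`. Initially it contains only colors
  -- below `c`, and jumps merely permute its contents.
  obtain ⟨d, hd, hds⟩ := hR.silent_right T y
  have hblock : IsBlock R T b d := ⟨hyb.trans hd, hb, hds⟩
  have := hη.block_induction hR hblock (fun ζ => ∀ z, ζ z < c) zero_le ht ?_ ?_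
  · have h2 := this y
    rw [restr_apply_of_mem hyb hd.le] at h2
    exact h2.not_ge hy
  · intro z
    unfold restr
    split_ifs with hz
    · exact lt_of_not_ge fun hc => hz.1.not_ge (h z hc)
    · exact WithBot.bot_lt_coe c
  · intro r x _ _ _ _ _ ζ hζ z
    unfold jump
    split_ifs
    · exact hζ _
    · exact hζ z

theorem exists_block_forall (hR : GoodClocks R) (hη : IsTrajectory R η)
    (h0 : Admissible C (η 0)) (T : ℝ≥0) :
    ∃ a b, IsBlock R T a b ∧ ∀ t ≤ T, Admissible C (restr a b (η t)) ∧
      ∀ i, ∀ y ∈ colorSet (C i) (η t), y ≤ b := by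
  obtain ⟨a, b, hb, hadm, hright⟩ := exists_block hR T h0
  refine ⟨a, b, hb, fun t ht => ⟨?_, fun i => ?_⟩⟩
  · exact hη.block_induction hR hb (Admissible C) zero_le ht hadm
      fun r x _ _ _ _ _ ζ hζ => hζ.jump x
  · exact hη.colorSet_le hR hb.right (hright i) ht

theorem IsTrajectory.admissible (hR : GoodClocks R) (hη : IsTrajectory R η)
    (h0 : Admissible C (η 0)) (t : ℝ≥0) : Admissible C (η t) := by
  obtain ⟨a, b, -, h⟩ := exists_block_forall hR hη h0 t
  exact admissible_of_restr (h t le_rfl).1 (h t le_rfl).2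

/-- The particles at the recursive maxima follow the graphical construction. -/
theorem IsTrajectory.particles_maxima (hC : StrictMono C) (hR : GoodClocks R)
    (hη : IsTrajectory R η) (h0 : Admissible C (η 0)) :
    IsTrajectory R fun t => particles (maxima C (η t)) := by
  constructor
  · intro y s t hst hring
    obtain ⟨a, b, hb, h⟩ := exists_block_forall hR hη h0 t
    rw [maxima_restr (h t le_rfl).1 (h t le_rfl).2, maxima_restr (h s hst).1 (h s hst).2]
    -- The invariant includes admissibility, because the commutation of maxima and jumps needs it at
    -- each ring.
    refine (hη.block_induction hR hb (fun ζ => Admissible C ζ ∧ particles (maxima C ζ) y =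
      particles (maxima C (restr a b (η s))) y) hst le_rfl ⟨(h s hst).1, rfl⟩ ?_).2
    rintro r x h1 h2 - - hx ζ ⟨hζ, e⟩
    refine ⟨hζ.jump x, ?_⟩
    rw [particles_maxima_jump hC hζ, jump_apply_of_ne, e]
    · rintro rfl
      exact (hring r h1 h2).2 hx
    · rintro rfl
      refine (hring r h1 h2).1 ?_
      rwa [add_sub_cancel_right]
  · intro x t hx
    obtain ⟨a, b, hb, h⟩ := exists_block_forall hR hη h0 t
    by_cases hin : a < x ∧ x < b
    · filter_upwards [hη.eventually_restr_eq hR hb le_rfl hx hin.1 hin.2,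
        eventually_mem_nhdsWithin] with s hs hst
      have hst : s ≤ t := le_of_lt hst
      rw [maxima_restr (h t le_rfl).1 (h t le_rfl).2, maxima_restr (h s hst).1 (h s hst).2, hs,
        particles_maxima_jump hC (h s hst).1]
      exact ⟨rfl, rfl⟩
    · have hxa : x ≠ a := fun e => hb.left t le_rfl (e ▸ hx)
      have hxb : x ≠ b := fun e => hb.right t le_rfl (e ▸ hx)
      -- The ringing bond lies outside the block, where there are no marked particles, so its jump
      -- does nothing to them.
      have hbot : ∀ s ≤ t, ∀ y, y ≤ a ∨ b < y → particles (maxima C (η s)) y = ⊥ := by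
        intro s hs y hy
        rw [maxima_restr (h s hs).1 (h s hs).2]
        refine particles_eq_bot fun i e => ?_
        have := (colorSet_restr_subset _ _ (maxima_mem (h s hs).1 i)).2
        rw [e, Set.mem_Ioc] at this
        omega
      filter_upwards [eventually_mem_nhdsWithin] with s hst
      have hst : s ≤ t := le_of_lt hst
      have e1 := hbot s hst x (by omega)
      have e2 := hbot s hst (x + 1) (by omega)
      rw [jump_of_not_lt (by rw [e1, e2]; exact lt_irrefl _), e1, e2]
      exact ⟨hbot t le_rfl x (by omega), hbot t le_rfl (x + 1) (by omega)⟩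

end MaximaTrajectory

/-! ### Approximation on a mesh -/

section Mesh

open Classical in
/-- The effect of the clock at the bond `(x, x + 1)` in the time interval `(s, t]`, if it rings at
most once. -/
noncomputable def slotStep (R : ℤ → Set ℝ≥0) (s t : ℝ≥0) (x : ℤ) (ζ : Config) : Config :=
  if ∃ r ∈ R x, s < r ∧ r ≤ t then jump x ζ else ζ

/-- The effect of the first `N` bonds (in an enumeration of all bonds), one after another. -/
noncomputable def slotSweep (R : ℤ → Set ℝ≥0) (s t : ℝ≥0) : ℕ → Config → Config
  | 0, ζ => ζ
  | N + 1, ζ => slotStep R s t (Denumerable.ofNat ℤ N) (slotSweep R s t N ζ)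

/-- The approximation of the configuration at time `k * δ`, by mesh width `δ` and the first `N`
bonds. -/
noncomputable def meshApprox (R : ℤ → Set ℝ≥0) (N : ℕ) (δ : ℝ≥0) (ζ : Config) : ℕ → Config
  | 0 => ζ
  | k + 1 => slotSweep R (k * δ) ((k + 1 : ℕ) * δ) N (meshApprox R N δ ζ k)

variable {R : ℤ → Set ℝ≥0} {η : ℝ≥0 → Config} {T : ℝ≥0} {a b : ℤ}

theorem restr_slotStep_of_no_ring {s t : ℝ≥0} {x : ℤ}
    (h : a ≤ x → x ≤ b → ∀ r, s < r → r ≤ t → r ∉ R x) (ζ : Config) :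
    restr a b (slotStep R s t x ζ) = restr a b ζ := by
  unfold slotStep
  split_ifs with hr
  · obtain ⟨r, hr, h1, h2⟩ := hr
    refine restr_jump_of_not_mem ?_ ζ
    by_contra hx
    exact h (by omega) (by omega) r h1 h2 hr
  · rfl

theorem restr_slotSweep_of_no_ring {s t : ℝ≥0} (N : ℕ)
    (h : ∀ j < N, a ≤ Denumerable.ofNat ℤ j → Denumerable.ofNat ℤ j ≤ b →
      ∀ r, s < r → r ≤ t → r ∉ R (Denumerable.ofNat ℤ j)) (ζ : Config) :
    restr a b (slotSweep R s t N ζ) = restr a b ζ := by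
  induction N with
  | zero => rfl
  | succ N ih =>
    rw [slotSweep, restr_slotStep_of_no_ring (h N N.lt_succ_self),
      ih fun j hj => h j (hj.trans N.lt_succ_self)]

/-- The order of the sweep is immaterial: `x` is the only bond in the slot that acts on the block,
and the sweep must be long enough to reach its index. -/
theorem restr_slotSweep_of_ring {s r t : ℝ≥0} {x : ℤ} (hx : r ∈ R x) (hsr : s < r) (hrt : r ≤ t)
    (hax : a < x) (hxb : x < b)
    (h : ∀ z, z ≠ x → a ≤ z → z ≤ b → ∀ r', s < r' → r' ≤ t → r' ∉ R z) (N : ℕ)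
    (hN : Encodable.encode x < N) (ζ : Config) :
    restr a b (slotSweep R s t N ζ) = jump x (restr a b ζ) := by
  induction N with
  | zero => exact absurd hN (Nat.not_lt_zero _)
  | succ N ih =>
    rw [slotSweep]
    rcases (Nat.lt_succ_iff.1 hN).eq_or_lt with he | hlt
    · have hNx : Denumerable.ofNat ℤ N = x := by rw [← he, Denumerable.ofNat_encode]
      rw [hNx, slotStep, if_pos ⟨r, hx, hsr, hrt⟩, restr_jump hax hxb,
        restr_slotSweep_of_no_ring]
      intro j hj h1 h2
      refine h _ (fun e => ?_) h1 h2
      rw [← e, Denumerable.encode_ofNat] at he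
      omega
    · rw [restr_slotStep_of_no_ring, ih hlt]
      refine h _ fun e => ?_
      rw [← e, Denumerable.encode_ofNat] at hlt
      exact lt_irrefl _ hlt

/-- For fine meshes and sufficiently many bonds the approximation is exact at any given site. -/
theorem IsTrajectory.eventually_meshApprox (hR : GoodClocks R) (hη : IsTrajectory R η)
    (t : ℝ≥0) (y : ℤ) :
    ∀ᶠ m : ℕ in atTop, meshApprox R m (t / m) (η 0) m y = η t y := by
  obtain ⟨b, hyb, hbs⟩ := hR.silent_right t y
  obtain ⟨a, hya, has⟩ := hR.silent_left t y
  have hb : IsBlock R t a b := ⟨hya.trans hyb, has, hbs⟩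
  set F := {r | r ≤ t ∧ ∃ x, a < x ∧ x < b ∧ r ∈ R x} with hF
  have hFfin : F.Finite := hR.finite_block t a b
  have hlim : Tendsto (fun m : ℕ => ((t / m : ℝ≥0) : ℝ)) atTop (𝓝 0) := by
    simpa using tendsto_const_div_atTop_nhds_zero_nat (t : ℝ)
  -- A mesh finer than every distance between ring times of the block leaves at most one of them in
  -- each slot.
  have hsep : ∀ᶠ m : ℕ in atTop, ∀ r ∈ F, ∀ r' ∈ F, r < r' → ((t / m : ℝ≥0) : ℝ) < r' - r := by
    rw [eventually_all_finite hFfin]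
    intro r _
    rw [eventually_all_finite hFfin]
    intro r' _
    by_cases hr : r < r'
    · have : (0 : ℝ) < r' - r := sub_pos.2 (by exact_mod_cast hr)
      filter_upwards [hlim.eventually (gt_mem_nhds this)] with m hm _ using hm
    · exact Eventually.of_forall fun m h => absurd h hr
  have hbonds : ∀ᶠ m : ℕ in atTop, ∀ x ∈ Set.Ioo a b, Encodable.encode x < m := by
    rw [eventually_all_finite (Set.finite_Ioo a b)]
    exact fun x _ => eventually_gt_atTop _
  filter_upwards [hsep, hbonds, eventually_gt_atTop 0] with m hsep hbonds hm
  set δ := t / m with hδ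
  have hmδ : (m : ℝ≥0) * δ = t := by
    rw [hδ, mul_div_cancel₀]
    exact_mod_cast hm.ne'
  have hkδ : ∀ k ≤ m, (k : ℝ≥0) * δ ≤ t := fun k hk => by
    rw [← hmδ]
    gcongr
  have main : ∀ k ≤ m, restr a b (meshApprox R m δ (η 0) k) = restr a b (η (k * δ)) := by
    intro k
    induction k with
    | zero => simp [meshApprox]
    | succ k ih =>
      intro hk
      have ih := ih (by omega)
      have hT := hkδ _ hk
      have hstep : (k : ℝ≥0) * δ ≤ (k + 1 : ℕ) * δ := by
        gcongr
        omega
      have hwidth : (((k + 1 : ℕ) * δ : ℝ≥0) : ℝ) - ((k * δ : ℝ≥0) : ℝ) = δ := by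
        push_cast
        ring
      rw [meshApprox]
      by_cases hring : ∃ r x, (k : ℝ≥0) * δ < r ∧ r ≤ (k + 1 : ℕ) * δ ∧ a < x ∧ x < b ∧ r ∈ R x
      · obtain ⟨r, x, h1, h2, hax, hxb, hx⟩ := hring
        have huniq : ∀ r' z, (k : ℝ≥0) * δ < r' → r' ≤ (k + 1 : ℕ) * δ → a < z → z < b →
            r' ∈ R z → r' = r := by
          intro r' z h3 h4 h5 h6 h7
          have m1 : r ∈ F := ⟨h2.trans hT, x, hax, hxb, hx⟩
          have m2 : r' ∈ F := ⟨h4.trans hT, z, h5, h6, h7⟩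
          have h1' := NNReal.coe_lt_coe.2 h1
          have h2' := NNReal.coe_le_coe.2 h2
          have h3' := NNReal.coe_lt_coe.2 h3
          have h4' := NNReal.coe_le_coe.2 h4
          rcases lt_trichotomy r' r with hlt | he | hlt
          · have := hsep r' m2 r m1 hlt
            linarith
          · exact he
          · have := hsep r m1 r' m2 hlt
            linarith
        rw [hη.restr_eq_jump hR hb h1 h2 hT hx hax hxb huniq,
          restr_slotSweep_of_ring hx h1 h2 hax hxb _ m (hbonds x ⟨hax, hxb⟩), ih]
        intro z hz h3 h4 r' h5 h6 h7
        rcases h3.eq_or_lt with rfl | h3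
        · exact hb.left r' (h6.trans hT) h7
        rcases h4.eq_or_lt with rfl | h4
        · exact hb.right r' (h6.trans hT) h7
        have := huniq r' z h5 h6 h3 h4 h7
        subst this
        exact hz (hR.disjoint _ _ _ h7 hx)
      · rw [hη.restr_eq hb hstep hT fun r x h1 h2 h3 h4 h5 =>
          hring ⟨r, x, h1, h2, h3, h4, h5⟩, restr_slotSweep_of_no_ring, ih]
        intro j _ h3 h4 r h5 h6 h7
        rcases h3.eq_or_lt with he | h3
        · rw [← he] at h7
          exact hb.left r (h6.trans hT) h7
        rcases h4.eq_or_lt with he | h4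
        · rw [he] at h7
          exact hb.right r (h6.trans hT) h7
        exact hring ⟨r, _, h5, h6, h3, h4, h7⟩
  have := congrFun (main m le_rfl) y
  rwa [restr_apply_of_mem hya hyb.le, restr_apply_of_mem hya hyb.le, hmδ] at this

end Mesh

/-! ### Almost sure properties of the clocks -/

section CanonicalClocks

/-- The law of the waiting times of a family of independent rate `1` Poisson clocks. -/
noncomputable def gapLaw : Measure (ℤ × ℕ → ℝ) := Measure.infinitePi fun _ => expMeasure 1

instance : IsProbabilityMeasure (expMeasure 1) := isProbabilityMeasure_expMeasure one_pos

instance : IsProbabilityMeasure gapLaw := by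
  unfold gapLaw
  infer_instance

/-- The ring times for given waiting times. -/
def ringSet (g : ℤ × ℕ → ℝ) : ℤ → Set ℝ≥0 :=
  ringTimes (fun x k (g : ℤ × ℕ → ℝ) => g (x, k)) g

instance : NullSingletonClass (expMeasure 1) :=
  nullSingletonClass_withDensity _

theorem expMeasure_Iic (T : ℝ) (hT : 0 ≤ T) :
    expMeasure 1 (Set.Iic T) = ENNReal.ofReal (1 - Real.exp (-T)) := by
  rw [← ofReal_cdf, cdf_expMeasure_eq one_pos, if_pos hT, one_mul]

theorem map_eval_gapLaw (p : ℤ × ℕ) : gapLaw.map (fun g => g p) = expMeasure 1 :=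
  Measure.infinitePi_map_eval _ p

theorem ae_gapLaw_pos : ∀ᵐ g ∂gapLaw, ∀ p, 0 < g p := by
  rw [ae_all_iff]
  intro p
  have h : ∀ᵐ u ∂(expMeasure 1), 0 < u := by
    rw [ae_iff]
    simp only [not_lt]
    change expMeasure 1 (Set.Iic 0) = 0
    rw [expMeasure_Iic 0 le_rfl]
    simp
  rw [← map_eval_gapLaw p] at h
  exact ae_of_ae_map (measurable_pi_apply p).aemeasurable h

/-- Any infinite family of waiting times is almost surely unbounded. -/
theorem ae_gapLaw_exists_gt (p : ℕ → ℤ × ℕ) (hp : Function.Injective p) (T : ℝ≥0) :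
    ∀ᵐ g ∂gapLaw, ∃ m, (T : ℝ) < g (p m) := by
  rw [ae_iff]
  push Not
  set q : ℝ≥0∞ := ENNReal.ofReal (1 - Real.exp (-T)) with hq
  have hq1 : q < 1 := by
    rw [hq, ENNReal.ofReal_lt_one]
    linarith [Real.exp_pos (-(T : ℝ))]
  -- Only the first `M` of the waiting times are constrained; they are independent, each at most `T`
  -- with probability `q < 1`.
  have hle : ∀ M : ℕ, gapLaw {g | ∀ m, g (p m) ≤ T} ≤ q ^ M := by
    intro M
    have hsub : {g : ℤ × ℕ → ℝ | ∀ m, g (p m) ≤ T} ⊆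
        Set.pi ((Finset.range M).map ⟨p, hp⟩ : Finset (ℤ × ℕ)) fun _ => Set.Iic (T : ℝ) := by
      intro g hg i hi
      obtain ⟨m, -, rfl⟩ := Finset.mem_map.1 (Finset.mem_coe.1 hi)
      exact hg m
    refine (measure_mono hsub).trans ?_
    rw [gapLaw, Measure.infinitePi_pi _ fun _ _ => measurableSet_Iic]
    simp [expMeasure_Iic T T.2, hq]
  exact le_antisymm (ge_of_tendsto' (ENNReal.tendsto_pow_atTop_nhds_zero_of_lt_one hq1) hle)
    zero_le

theorem iIndepFun_gapLaw : iIndepFun (fun (p : ℤ × ℕ) (g : ℤ × ℕ → ℝ) => g p) gapLaw :=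
  iIndepFun_infinitePi (P := fun _ : ℤ × ℕ => expMeasure 1) (X := fun _ u => u)
    fun _ => measurable_id

/-- A random variable without atoms almost surely differs from an independent one. -/
theorem ae_ne_of_indepFun {Ω : Type*} [MeasurableSpace Ω] {P : Measure Ω} [IsProbabilityMeasure P]
    {X Y : Ω → ℝ} (hX : Measurable X) (hY : Measurable Y) [NullSingletonClass (P.map X)]
    (h : IndepFun X Y P) : ∀ᵐ ω ∂P, X ω ≠ Y ω := by
  have := Measure.isProbabilityMeasure_map (μ := P) hX.aemeasurable
  have := Measure.isProbabilityMeasure_map (μ := P) hY.aemeasurable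
  have hprod := (indepFun_iff_map_prod_eq_prod_map_map hX.aemeasurable hY.aemeasurable).1 h
  have hae : ∀ᵐ z ∂(P.map fun ω => (X ω, Y ω)), z.1 ≠ z.2 := by
    rw [hprod, ae_iff]
    simp only [not_not]
    rw [Measure.prod_apply_symm (measurableSet_eq_fun measurable_fst measurable_snd)]
    simp
  exact ae_of_ae_map (hX.prodMk hY).aemeasurable hae

/-- A coincidence of the two ring times would express the last waiting time `g (x, k)` through
waiting times with other indices, which are independent of it; its law has no atoms. -/
theorem ae_gapLaw_sum_ne {x y : ℤ} (hxy : x ≠ y) (k l : ℕ) :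
    ∀ᵐ g ∂gapLaw, ∑ j ∈ Finset.range (k + 1), g (x, j) ≠ ∑ j ∈ Finset.range (l + 1), g (y, j) := by
  set S : Finset (ℤ × ℕ) := {(x, k)} with hS
  set U : Finset (ℤ × ℕ) := (Finset.range k).map ⟨fun j => (x, j), Prod.mk_right_injective x⟩ ∪
    (Finset.range (l + 1)).map ⟨fun j => (y, j), Prod.mk_right_injective y⟩ with hU
  have hdisj : Disjoint S U := by
    rw [hS, Finset.disjoint_singleton_left, hU, Finset.mem_union, Finset.mem_map, Finset.mem_map]
    rintro (⟨j, hj, he⟩ | ⟨j, hj, he⟩)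
    · simp only [Function.Embedding.coeFn_mk, Prod.mk.injEq, true_and] at he
      simp [he] at hj
    · simp only [Function.Embedding.coeFn_mk, Prod.mk.injEq] at he
      exact hxy he.1.symm
  have hind := iIndepFun_gapLaw.indepFun_finset S U hdisj fun p => measurable_pi_apply p
  have hmem1 : ∀ j ∈ Finset.range k, (x, j) ∈ U := fun j hj =>
    Finset.mem_union_left _ (Finset.mem_map.2 ⟨j, hj, rfl⟩)
  have hmem2 : ∀ j ∈ Finset.range (l + 1), (y, j) ∈ U := fun j hj =>
    Finset.mem_union_right _ (Finset.mem_map.2 ⟨j, hj, rfl⟩)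
  have hind2 : IndepFun (fun g : ℤ × ℕ → ℝ => g (x, k))
      (fun g => ∑ j ∈ Finset.range (l + 1), g (y, j) - ∑ j ∈ Finset.range k, g (x, j)) gapLaw := by
    have hφ : Measurable fun f : S → ℝ => f ⟨(x, k), Finset.mem_singleton_self _⟩ :=
      measurable_pi_apply _
    have hψ : Measurable fun f : U → ℝ =>
        ∑ j ∈ (Finset.range (l + 1)).attach, f ⟨(y, j), hmem2 j j.2⟩ -
          ∑ j ∈ (Finset.range k).attach, f ⟨(x, j), hmem1 j j.2⟩ := by
      fun_prop
    have := hind.comp hφ hψ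
    convert this using 1
    · rfl
    · funext g
      simp only [Function.comp_apply]
      rw [Finset.sum_attach (Finset.range (l + 1)) fun j => g (y, j),
        Finset.sum_attach (Finset.range k) fun j => g (x, j)]
  have : NullSingletonClass (gapLaw.map fun g : ℤ × ℕ → ℝ => g (x, k)) := by
    rw [map_eval_gapLaw]
    infer_instance
  filter_upwards [ae_ne_of_indepFun (by fun_prop) (by fun_prop) hind2] with g hg he
  rw [Finset.sum_range_succ] at he
  exact hg (by linarith)

/-- Unbounded waiting times at one bond leave only finitely many rings in bounded time. Unbounded
first waiting times along each half-line provide the silent bonds. Integer horizons suffice, which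
keeps the exceptional sets countable in number. -/
theorem ae_goodClocks : ∀ᵐ g ∂gapLaw, GoodClocks (ringSet g) := by
  have h1 : ∀ᵐ g ∂gapLaw, ∀ (x : ℤ) (T : ℕ), ∃ m, ((T : ℝ≥0) : ℝ) < g (x, m) := by
    simp only [ae_all_iff]
    exact fun x T => ae_gapLaw_exists_gt (fun m => (x, m)) (Prod.mk_right_injective x) T
  have h2 : ∀ᵐ g ∂gapLaw, ∀ (a : ℤ) (T : ℕ), ∃ m : ℕ, ((T : ℝ≥0) : ℝ) < g (a + 1 + m, 0) := by
    simp only [ae_all_iff]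
    refine fun a T => ae_gapLaw_exists_gt (fun m => (a + 1 + m, 0)) (fun m m' h => ?_) T
    simpa using h
  have h3 : ∀ᵐ g ∂gapLaw, ∀ (a : ℤ) (T : ℕ), ∃ m : ℕ, ((T : ℝ≥0) : ℝ) < g (a - 1 - m, 0) := by
    simp only [ae_all_iff]
    refine fun a T => ae_gapLaw_exists_gt (fun m => (a - 1 - m, 0)) (fun m m' h => ?_) T
    simpa using h
  have h4 : ∀ᵐ g ∂gapLaw, ∀ (x y : ℤ) (_ : x ≠ y) (k l : ℕ),
      ∑ j ∈ Finset.range (k + 1), g (x, j) ≠ ∑ j ∈ Finset.range (l + 1), g (y, j) := by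
    simp only [ae_all_iff]
    exact fun x y hxy k l => ae_gapLaw_sum_ne hxy k l
  filter_upwards [ae_gapLaw_pos, h1, h2, h3, h4] with g hpos h1 h2 h3 h4
  have hge : ∀ x m k, m ≤ k → g (x, m) ≤ ∑ j ∈ Finset.range (k + 1), g (x, j) := fun x m k hmk =>
    Finset.single_le_sum (f := fun j => g (x, j)) (fun j _ => (hpos (x, j)).le)
      (Finset.mem_range.2 (by omega))
  have hsilent : ∀ (x : ℤ) (T : ℝ≥0), ((⌈T⌉₊ : ℝ≥0) : ℝ) < g (x, 0) → ∀ t ≤ T, t ∉ ringSet g x := by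
    rintro x T hT t ht ⟨k, hk⟩
    have e1 := hge x 0 k (Nat.zero_le k)
    have e2 : ((T : ℝ≥0) : ℝ) ≤ ((⌈T⌉₊ : ℝ≥0) : ℝ) := NNReal.coe_le_coe.2 (Nat.le_ceil T)
    have e3 : (t : ℝ) ≤ T := NNReal.coe_le_coe.2 ht
    have e4 : ∑ j ∈ Finset.range (k + 1), g (x, j) = t := hk
    linarith
  constructor
  · intro x T
    obtain ⟨m, hm⟩ := h1 x ⌈T⌉₊
    refine ((Set.finite_Iio m).image
      fun k => (∑ j ∈ Finset.range (k + 1), g (x, j)).toNNReal).subset ?_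
    rintro t ⟨⟨k, hk⟩, ht⟩
    have e4 : ∑ j ∈ Finset.range (k + 1), g (x, j) = t := hk
    refine ⟨k, ?_, ?_⟩
    · rw [Set.mem_Iio]
      by_contra hmk
      have e1 := hge x m k (not_lt.1 hmk)
      have e2 : ((T : ℝ≥0) : ℝ) ≤ ((⌈T⌉₊ : ℝ≥0) : ℝ) := NNReal.coe_le_coe.2 (Nat.le_ceil T)
      have e3 : (t : ℝ) ≤ T := NNReal.coe_le_coe.2 ht
      linarith
    · dsimp only
      rw [e4, Real.toNNReal_coe]
  · rintro x y t ⟨k, hk⟩ ⟨l, hl⟩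
    by_contra hxy
    exact h4 x y hxy k l (hk.trans hl.symm)
  · intro T a
    obtain ⟨m, hm⟩ := h3 a ⌈T⌉₊
    exact ⟨_, by omega, hsilent _ T hm⟩
  · intro T a
    obtain ⟨m, hm⟩ := h2 a ⌈T⌉₊
    exact ⟨_, by omega, hsilent _ T hm⟩

end CanonicalClocks

/-! ### Transfer from the canonical clocks to an arbitrary clock family. -/

section ClockFamily

variable {Ω : Type*} [MeasurableSpace Ω] {P : Measure Ω}
  {gap : ℤ → ℕ → Ω → ℝ}

theorem IsClockFamily.aemeasurable (h : IsClockFamily P gap) :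
    AEMeasurable (fun ω (p : ℤ × ℕ) => gap p.1 p.2 ω) P :=
  aemeasurable_pi_iff.2 fun p => (h.exponential p.1 p.2).aemeasurable

theorem IsClockFamily.map_eq [IsProbabilityMeasure P] (h : IsClockFamily P gap) :
    P.map (fun ω (p : ℤ × ℕ) => gap p.1 p.2 ω) = gapLaw := by
  rw [(iIndepFun_iff_map_fun_eq_infinitePi_map₀ h.aemeasurable).1 h.indep, gapLaw]
  congr 1
  funext p
  exact (h.exponential p.1 p.2).map_eq

theorem IsClockFamily.ae_goodClocks [IsProbabilityMeasure P] (h : IsClockFamily P gap) :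
    ∀ᵐ ω ∂P, GoodClocks (ringTimes gap ω) := by
  have := ColoredTASEP.ae_goodClocks
  rw [← h.map_eq] at this
  exact ae_of_ae_map h.aemeasurable this

end ClockFamily

/-! ### Uniqueness in law -/

section Law

theorem measurable_jump (x : ℤ) : Measurable (jump x) := by
  have : DiscreteMeasurableSpace (WithBot ℤ) := ⟨fun _ => trivial⟩
  have hset : MeasurableSet {ζ : Config | ζ (x + 1) < ζ x} :=
    measurableSet_preimage (f := fun ζ : Config => (ζ (x + 1), ζ x))
      ((measurable_pi_apply (x + 1)).prodMk (measurable_pi_apply x))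
      (MeasurableSet.of_discrete (s := {p : WithBot ℤ × WithBot ℤ | p.1 < p.2}))
  unfold jump
  refine Measurable.ite hset ?_ measurable_id
  exact measurable_pi_iff.2 fun y => measurable_pi_apply _

theorem measurable_slotStep (s t : ℝ≥0) (x : ℤ) {F : (ℤ × ℕ → ℝ) → Config} (hF : Measurable F) :
    Measurable fun g => slotStep (ringSet g) s t x (F g) := by
  have hset : MeasurableSet {g | ∃ r ∈ ringSet g x, s < r ∧ r ≤ t} := by
    have e : {g | ∃ r ∈ ringSet g x, s < r ∧ r ≤ t} =
        ⋃ k : ℕ, (fun g : ℤ × ℕ → ℝ => ∑ j ∈ Finset.range (k + 1), g (x, j)) ⁻¹'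
          Set.Ioc (s : ℝ) t := by
      ext g
      simp only [Set.mem_iUnion, Set.mem_preimage, Set.mem_Ioc]
      constructor
      · rintro ⟨r, ⟨k, hk⟩, h1, h2⟩
        refine ⟨k, ?_⟩
        have hk : ∑ j ∈ Finset.range (k + 1), g (x, j) = r := hk
        rw [hk]
        exact ⟨NNReal.coe_lt_coe.2 h1, NNReal.coe_le_coe.2 h2⟩
      · rintro ⟨k, h1, h2⟩
        -- The partial sum exceeds `s ≥ 0`, so it is a legitimate time in `ℝ≥0`.
        refine ⟨⟨_, s.2.trans h1.le⟩, ⟨k, rfl⟩, ?_, ?_⟩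
        · exact NNReal.coe_lt_coe.1 h1
        · exact NNReal.coe_le_coe.1 h2
    rw [e]
    exact MeasurableSet.iUnion fun k => measurableSet_Ioc.preimage (by fun_prop)
  unfold slotStep
  exact Measurable.ite hset ((measurable_jump x).comp hF) hF

theorem measurable_slotSweep (s t : ℝ≥0) (N : ℕ) {F : (ℤ × ℕ → ℝ) → Config} (hF : Measurable F) :
    Measurable fun g => slotSweep (ringSet g) s t N (F g) := by
  induction N with
  | zero => exact hF
  | succ N ih => exact measurable_slotStep s t _ ih

theorem measurable_meshApprox (N : ℕ) (δ : ℝ≥0) (ζ : Config) (k : ℕ) :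
    Measurable fun g => meshApprox (ringSet g) N δ ζ k := by
  induction k with
  | zero => exact measurable_const
  | succ k ih => exact measurable_slotSweep _ _ N ih

/-- The probability that finitely many sites have given contents at given times is, for a colored
TASEP from the deterministic initial configuration `ζ`, a function of the law of the clocks. -/
theorem IsColoredTASEP.measure_eq {Ω : Type*} [MeasurableSpace Ω] {P : Measure Ω}
    [IsProbabilityMeasure P] {gap : ℤ → ℕ → Ω → ℝ} {ξ : ℝ≥0 → Ω → Config}
    (h : IsColoredTASEP P gap ξ) {ζ : Config} (h0 : ∀ᵐ ω ∂P, ξ 0 ω = ζ)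
    {ι : Type*} [Finite ι] (t : ι → ℝ≥0) (y : ι → ℤ) (c : ι → WithBot ℤ) :
    P {ω | ∀ i, ξ (t i) ω (y i) = c i} =
      gapLaw {g | ∀ᶠ m : ℕ in atTop, ∀ i,
        meshApprox (ringSet g) m (t i / m) ζ m (y i) = c i} := by
  have hmeas : MeasurableSet {g | ∀ᶠ m : ℕ in atTop, ∀ i,
      meshApprox (ringSet g) m (t i / m) ζ m (y i) = c i} := by
    have e : {g | ∀ᶠ m : ℕ in atTop, ∀ i, meshApprox (ringSet g) m (t i / m) ζ m (y i) = c i} =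
        ⋃ M : ℕ, ⋂ m ≥ M, ⋂ i, (fun g => meshApprox (ringSet g) m (t i / m) ζ m (y i)) ⁻¹'
          {c i} := by
      ext g
      simp [eventually_atTop]
    rw [e]
    refine MeasurableSet.iUnion fun M => MeasurableSet.iInter fun m => MeasurableSet.iInter
      fun _ => MeasurableSet.iInter fun i => ?_
    exact MeasurableSet.preimage trivial
      ((measurable_pi_apply (y i)).comp (measurable_meshApprox _ _ _ _))
  rw [← h.clocks.map_eq, Measure.map_apply_of_aemeasurable h.clocks.aemeasurable hmeas]
  -- The event in `Ω` need not be measurable; it agrees almost surely with the preimage of a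
  -- measurable set of waiting times.
  refine measure_congr ?_
  filter_upwards [h.trajectory, h.clocks.ae_goodClocks, h0] with ω hω hR h0
  have hev : ∀ᶠ m : ℕ in atTop, ∀ i,
      meshApprox (ringTimes gap ω) m (t i / m) ζ m (y i) = ξ (t i) ω (y i) := by
    rw [eventually_all]
    intro i
    have := hω.eventually_meshApprox hR (t i) (y i)
    rwa [h0] at this
  refine propext ⟨fun hc => ?_, fun hc => ?_⟩
  · exact hev.mono fun m hm i => (hm i).trans (hc i)
  · obtain ⟨m, hm1, hm2⟩ := (hev.and hc).exists
    exact fun i => (hm1 i).symm.trans (hm2 i)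

end Law

end ColoredTASEP

/-! ### The proposition. -/

theorem proposition2p3
    {Ω : Type*} [MeasurableSpace Ω] (P : Measure Ω) [IsProbabilityMeasure P]
    (gap : ℤ → ℕ → Ω → ℝ) (η : ℝ≥0 → Ω → ColoredTASEP.Config)
    -- a colored TASEP, with arbitrary (random or deterministic) initial configuration `η 0`
    (hη : ColoredTASEP.IsColoredTASEP P gap η)
    (n : ℕ) (hn : 1 ≤ n) (C : Fin n → ℤ) (hC : StrictMono C) (ν : Fin n → ℤ)
    -- `M_C(0)` is well-defined and deterministic, equal to `ν`
    (hadm : ∀ᵐ ω ∂P, ColoredTASEP.Admissible C (η 0 ω))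
    (hν : ∀ᵐ ω ∂P, ColoredTASEP.maxima C (η 0 ω) = ν) :
    -- almost surely `M_C(t)` is well-defined at all times
    (∀ᵐ ω ∂P, ∀ t : ℝ≥0, ColoredTASEP.Admissible C (η t ω)) ∧
    -- the process of `n` particles of colors `1, …, n` at the positions `M_C(t)` is itself a
    -- colored TASEP, and its initial positions are `ν`
    (ColoredTASEP.IsColoredTASEP P gap
        (fun t ω => ColoredTASEP.particles (ColoredTASEP.maxima C (η t ω))) ∧
      ∀ᵐ ω ∂P, ColoredTASEP.particles (ColoredTASEP.maxima C (η 0 ω)) =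
        ColoredTASEP.particles ν) ∧
    -- comparison with any colored TASEP `ξ` started from `n` particles of colors `1, …, n` at `ν`
    (∀ {Ω' : Type*} [MeasurableSpace Ω'] (P' : Measure Ω') [IsProbabilityMeasure P']
        (gap' : ℤ → ℕ → Ω' → ℝ) (ξ : ℝ≥0 → Ω' → ColoredTASEP.Config),
      ColoredTASEP.IsColoredTASEP P' gap' ξ →
      (∀ᵐ ω' ∂P', ξ 0 ω' = ColoredTASEP.particles ν) →
      -- equality of the one-time probabilities, i.e. of the transition probabilities from `ν` to `μ`
      (∀ (t : ℝ≥0) (μ : Fin n → ℤ),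
        P {ω | ColoredTASEP.maxima C (η t ω) = μ} =
          P' {ω' | ∀ i, ξ t ω' (μ i) = ColoredTASEP.label i}) ∧
      -- equality of all finite-dimensional distributions of the two processes
      (∀ (m : ℕ) (t : Fin m → ℝ≥0) (μ : Fin m → Fin n → ℤ),
        P {ω | ∀ j, ColoredTASEP.maxima C (η (t j) ω) = μ j} =
          P' {ω' | ∀ j i, ξ (t j) ω' (μ j i) = ColoredTASEP.label i})) := by
  have hgood := hη.clocks.ae_goodClocks
  have hall : ∀ᵐ ω ∂P, ∀ t : ℝ≥0, ColoredTASEP.Admissible C (η t ω) := by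
    filter_upwards [hη.trajectory, hgood, hadm] with ω hω hR h0 t
    exact hω.admissible hR h0 t
  have hinit : ∀ᵐ ω ∂P, ColoredTASEP.particles (ColoredTASEP.maxima C (η 0 ω)) =
      ColoredTASEP.particles ν := by
    filter_upwards [hν] with ω h
    rw [h]
  have hmax : ColoredTASEP.IsColoredTASEP P gap
      (fun t ω => ColoredTASEP.particles (ColoredTASEP.maxima C (η t ω))) := by
    -- The initial marked particles are almost surely constant, hence a.e. measurable and
    -- independent of the clocks; no measurability of `maxima` is needed.
    have hconst : (fun _ => ColoredTASEP.particles ν) =ᵐ[P]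
        fun ω => ColoredTASEP.particles (ColoredTASEP.maxima C (η 0 ω)) := by
      filter_upwards [hinit] with ω h using h.symm
    refine ⟨hη.clocks, aemeasurable_const.congr hconst, ?_, ?_⟩
    · exact (indepFun_const_left _ _).congr hconst EventuallyEq.rfl
    · filter_upwards [hη.trajectory, hgood, hadm] with ω hω hR h0
      exact hω.particles_maxima hC hR h0
  refine ⟨hall, ⟨hmax, hinit⟩, ?_⟩
  intro Ω' _ P' _ gap' ξ hξ hξ0
  have hfdd : ∀ (m : ℕ) (t : Fin m → ℝ≥0) (μ : Fin m → Fin n → ℤ),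
      P {ω | ∀ j, ColoredTASEP.maxima C (η (t j) ω) = μ j} =
        P' {ω' | ∀ j i, ξ (t j) ω' (μ j i) = ColoredTASEP.label i} := by
    intro m t μ
    -- Index the cylinder events by pairs of a time and a particle: at each chosen time, the site `μ
    -- p.1 p.2` carries the label of particle `p.2`.
    have e1 := hmax.measure_eq hinit (fun p : Fin m × Fin n => t p.1) (fun p => μ p.1 p.2)
      fun p => ColoredTASEP.label p.2
    have e2 := hξ.measure_eq hξ0 (fun p : Fin m × Fin n => t p.1) (fun p => μ p.1 p.2)
      fun p => ColoredTASEP.label p.2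
    simp only [Prod.forall] at e1 e2
    rw [e2, ← e1]
    refine measure_congr ?_
    filter_upwards [hall] with ω hω
    refine propext (forall_congr' fun j => ?_)
    rw [funext_iff]
    exact forall_congr' fun i =>
      (ColoredTASEP.particles_eq_label_iff (ColoredTASEP.maxima_injective (hω (t j)))).symm
  refine ⟨fun t μ => ?_, hfdd⟩
  simpa using hfdd 1 (fun _ => t) fun _ => μ
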